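/- For a positive integer $k$, let $\mathrm{Part}(k)$ denote the lattice of all partitions of the set $\{1,2,\dots,k\}$, ordered by refinement ($U\le V$ if and only if every block of $U$ is contained in a block of $V$). A lattice $L$ is called four-generated if it has a generating set with exactly four elements, that is, a four-element subset such that the smallest sublattice of $L$ (nonempty subset closed under binary joins and meets) containing it is $L$ itself. Then for every integer $n\ge 9$ the direct product $$\mathrm{Part}(n)\times\mathrm{Part}(n+1)\times\dots\times\mathrm{Part}(3n-14)$$ (with componentwise order) is a four-generated lattice. -/

import Mathlib

/-- `L` is four-generated: it has a generating set with exactly four elements, i.e. the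
smallest sublattice (set closed under binary joins and meets) containing it is all of `L`. -/
def IsFourGenerated (L : Type*) [Lattice L] : Prop :=
  ∃ X : Set L, X.ncard = 4 ∧ latticeClosure X = Set.univ

/-- The lattice of all partitions of an `n`-element set, ordered by refinement
(a partition lies below another if each of its blocks is contained in a block of the other). -/
abbrev PartLattice (n : ℕ) : Type := Setoid.Partitions (Fin n)

/-! On the vertices `0, …, L` of a path, `L` even, take the parity partition, the two matchings by
consecutive edges, and a partition marking both end edges and a pair `q, q + 2`. A set of even size
has one more vertex, which the matchings hang on opposite ends of the path. The marking meets the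
matchings in the two end edges. If a partition contains an edge, its join with a matching relates
vertices at distance two, and meeting with parity discards the rest; so `grow` widens an interval by
one vertex at each end. Intersecting intervals grown from opposite ends yields all intervals, hence
the atoms of distance one and two, and `atm_eq_of_two_paths` supplies the others. Thus four
partitions generate each factor (`mem_of_generators_mem`).

By `mem_of_separates` it remains to find, for each ordered pair of coordinates, a generated element
that is top in the first and bottom in the second. An edge against bottom suffices, since growth
turns the edge into top and fixes bottom. Among sizes of equal parity, `L` increases while `q`
decreases, so growth from the left end tells the coordinates apart in one order by the right end and
in the other by the marked pair. For sizes of opposite parity, the parity partition and the even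
matching exchange roles. -/

namespace PartitionPath

/-- The partition of `Fin N` into the fibres of a labelling of its elements. -/
def fib (N : ℕ) (f : ℕ → ℕ) : Setoid (Fin N) := Setoid.ker fun i : Fin N => f i

theorem fib_rel {N : ℕ} {f : ℕ → ℕ} {i j : Fin N} : fib N f i j ↔ f i = f j := Iff.rfl

theorem sup_left {T : Type*} {r s : Setoid T} {x y : T} (h : r x y) : (r ⊔ s) x y :=
  (le_sup_left : r ≤ r ⊔ s) h

theorem sup_right {T : Type*} {r s : Setoid T} {x y : T} (h : s x y) : (r ⊔ s) x y :=
  (le_sup_right : s ≤ r ⊔ s) h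

/-- The label of the two-block partition of the path `0, …, L`, by parity. -/
def parLab (L i : ℕ) : ℕ := if i ≤ L then i % 2 else 2

/-- The label of the matching `{0,1}, {2,3}, …` of the path; a vertex off the path joins
the first pair. -/
def evenLab (L i : ℕ) : ℕ := if i ≤ L then i / 2 else 0

/-- The label of the matching `{1,2}, {3,4}, …` of the path; a vertex off the path joins
the last pair. -/
def oddLab (L i : ℕ) : ℕ := if i ≤ L then (i + 1) / 2 else L / 2

/-- The label of the partition with blocks `{0,1}`, `{q,q+2}`, `{L-1,L}`
(the first two merged when `q = 1`). -/
def markLab (L q i : ℕ) : ℕ :=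
  if i = 0 then 1 else if i = q + 2 then q else if i = L then L - 1 else i

/-- The label of the partition whose only nontrivial block is the interval from `a` to `b`. -/
def itvLab (a b i : ℕ) : ℕ := if a ≤ i ∧ i ≤ b then a else i

abbrev par (N L : ℕ) : Setoid (Fin N) := fib N (parLab L)
abbrev evn (N L : ℕ) : Setoid (Fin N) := fib N (evenLab L)
abbrev odd (N L : ℕ) : Setoid (Fin N) := fib N (oddLab L)
abbrev mark (N L q : ℕ) : Setoid (Fin N) := fib N (markLab L q)
abbrev itv (N a b : ℕ) : Setoid (Fin N) := fib N (itvLab a b)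

/-- The atom joining `u` and `v`. -/
def atm {T : Type*} [DecidableEq T] (u v : T) : Setoid T := Setoid.ker fun i => if i = v then u else i

/-- `L` is the length of the path on which the partitions of `Fin N` are built. -/
structure IsLen (N L : ℕ) : Prop where
  even : L % 2 = 0
  lt : L < N
  le : N ≤ L + 2
  eight_le : 8 ≤ L

/-! ### Meets of the generating partitions -/

section labels
variable {N L q : ℕ}

theorem fib_le {f g : ℕ → ℕ} (h : ∀ i j, i < N → j < N → f i = f j → g i = g j) :
    fib N f ≤ fib N g :=
  fun i j hij => h i j i.2 j.2 hij

theorem fib_inf_le {f g k : ℕ → ℕ}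
    (h : ∀ i j, i < N → j < N → f i = f j → g i = g j → k i = k j) :
    fib N f ⊓ fib N g ≤ fib N k :=
  fun i j hij => h i j i.2 j.2 hij.1 hij.2

theorem fib_inf_eq_bot {f g : ℕ → ℕ}
    (h : ∀ i j, i < N → j < N → f i = f j → g i = g j → i = j) : fib N f ⊓ fib N g = ⊥ :=
  le_bot_iff.1 fun i j hij => Fin.ext (h i j i.2 j.2 hij.1 hij.2)

theorem par_inf_evn (h : IsLen N L) : par N L ⊓ evn N L = ⊥ := by
  obtain ⟨h1, h2, h3, h4⟩ := h
  refine fib_inf_eq_bot fun i j hi hj => ?_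
  unfold parLab evenLab
  split_ifs <;> (intros; omega)

theorem par_inf_odd (h : IsLen N L) : par N L ⊓ odd N L = ⊥ := by
  obtain ⟨h1, h2, h3, h4⟩ := h
  refine fib_inf_eq_bot fun i j hi hj => ?_
  unfold parLab oddLab
  split_ifs <;> (intros; omega)

theorem evn_inf_odd (h : IsLen N L) : evn N L ⊓ odd N L = ⊥ := by
  obtain ⟨h1, h2, h3, h4⟩ := h
  refine fib_inf_eq_bot fun i j hi hj => ?_
  unfold evenLab oddLab
  split_ifs <;> (intros; omega)

theorem mark_inf_evn (h : IsLen N L) (hq : 1 ≤ q) (hqL : q + 4 ≤ L) :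
    mark N L q ⊓ evn N L = itv N 0 1 := by
  obtain ⟨h1, h2, h3, h4⟩ := h
  refine le_antisymm (fib_inf_le fun i j hi hj => ?_)
    (le_inf (fib_le fun i j hi hj => ?_) (fib_le fun i j hi hj => ?_))
  · unfold markLab evenLab itvLab
    split_ifs <;> (intros; omega)
  · unfold markLab itvLab
    split_ifs <;> (intros; omega)
  · unfold evenLab itvLab
    split_ifs <;> (intros; omega)

theorem mark_inf_odd (h : IsLen N L) (hq : 1 ≤ q) (hqL : q + 4 ≤ L) :
    mark N L q ⊓ odd N L = itv N (L - 1) L := by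
  obtain ⟨h1, h2, h3, h4⟩ := h
  refine le_antisymm (fib_inf_le fun i j hi hj => ?_)
    (le_inf (fib_le fun i j hi hj => ?_) (fib_le fun i j hi hj => ?_))
  · unfold markLab oddLab itvLab
    split_ifs <;> (intros; omega)
  · unfold markLab itvLab
    split_ifs <;> (intros; omega)
  · unfold oddLab itvLab
    split_ifs <;> (intros; omega)

theorem mark_inf_par_rel (h : IsLen N L) (hq : 1 ≤ q) (hqL : q + 4 ≤ L) {i j : Fin N}
    (hi : (i : ℕ) = q) (hj : (j : ℕ) = q + 2) : (mark N L q ⊓ par N L) i j := by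
  obtain ⟨h1, h2, h3, h4⟩ := h
  refine ⟨?_, ?_⟩
  · change markLab L q i = markLab L q j
    unfold markLab; split_ifs <;> omega
  · change parLab L i = parLab L j
    unfold parLab; rw [hi, hj]; split_ifs <;> omega

theorem eq_of_mark_inf_par (h : IsLen N L) (hq : 1 ≤ q) (hqL : q + 4 ≤ L) {i j : Fin N}
    (hij : (mark N L q ⊓ par N L) i j) :
    i = j ∨ (i : ℕ) = q ∧ (j : ℕ) = q + 2 ∨ (i : ℕ) = q + 2 ∧ (j : ℕ) = q := by
  obtain ⟨h1, h2, h3, h4⟩ := h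
  obtain ⟨hm, hp⟩ := hij
  change markLab L q i = markLab L q j at hm
  change parLab L i = parLab L j at hp
  have hi := i.2
  have hj := j.2
  rw [Fin.ext_iff]
  revert hm hp
  unfold markLab parLab
  split_ifs <;> (intros; omega)

theorem itv_inf_itv (a b c d : ℕ) (hac : a ≤ c) (hbd : b ≤ d) :
    itv N a b ⊓ itv N c d = itv N c b := by
  refine le_antisymm (fib_inf_le fun i j hi hj => ?_)
    (le_inf (fib_le fun i j hi hj => ?_) (fib_le fun i j hi hj => ?_))
  all_goals
    unfold itvLab
    split_ifs <;> (intros; omega)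

end labels

/-! ### Growth of intervals along the path -/

section grow
variable {T : Type*} [Lattice T]

/-- One step of growth along the path. -/
def grow (a b c x : T) : T := x ⊔ (x ⊔ b) ⊓ a ⊔ (x ⊔ c) ⊓ a

end grow

section path
variable {N L q : ℕ}

/-- Each matching edge joins vertices of opposite parity, so outside the enlarged interval block
nothing survives the meet with parity. That block exceeds the interval by at most one path vertex on
each side; the vertex off the path, which it may also contain, is alone in its parity class. -/
theorem itv_sup_evn_inf_par (h : IsLen N L) {a b : ℕ} (hab : a < b) (hb : b ≤ L) :
    (itv N a b ⊔ evn N L) ⊓ par N L ≤ itv N (a - 1) (min (b + 1) L) := by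
  obtain ⟨h1, h2, h3, h4⟩ := h
  -- An upper bound for the join: merge all matching blocks that touch the interval.
  have key : itv N a b ⊔ evn N L ≤ fib N fun i =>
      if a / 2 ≤ evenLab L i ∧ evenLab L i ≤ b / 2 then a / 2 else evenLab L i := by
    refine sup_le (fun i j hij => ?_) fun i j hij => ?_
    · change itvLab a b i = itvLab a b j at hij
      rw [fib_rel]
      unfold itvLab at hij; unfold evenLab
      split_ifs at hij ⊢ <;> omega
    · have hij : evenLab L i = evenLab L j := hij
      rw [fib_rel, hij]
  refine fun i j ⟨hm, hp⟩ => ?_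
  have hm := fib_rel.1 (key hm)
  change parLab L i = parLab L j at hp
  change itvLab _ _ i = itvLab _ _ j
  have hi := i.2
  have hj := j.2
  unfold evenLab at hm; unfold parLab at hp; unfold itvLab
  split_ifs at hm hp ⊢ <;> omega

theorem itv_sup_odd_inf_par (h : IsLen N L) {a b : ℕ} (hab : a < b) (hb : b ≤ L) :
    (itv N a b ⊔ odd N L) ⊓ par N L ≤ itv N (a - 1) (min (b + 1) L) := by
  obtain ⟨h1, h2, h3, h4⟩ := h
  have key : itv N a b ⊔ odd N L ≤ fib N fun i =>
      if (a + 1) / 2 ≤ oddLab L i ∧ oddLab L i ≤ (b + 1) / 2 then (a + 1) / 2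
      else oddLab L i := by
    refine sup_le (fun i j hij => ?_) fun i j hij => ?_
    · change itvLab a b i = itvLab a b j at hij
      rw [fib_rel]
      unfold itvLab at hij; unfold oddLab
      split_ifs at hij ⊢ <;> omega
    · have hij : oddLab L i = oddLab L j := hij
      rw [fib_rel, hij]
  refine fun i j ⟨hm, hp⟩ => ?_
  have hm := fib_rel.1 (key hm)
  change parLab L i = parLab L j at hp
  change itvLab _ _ i = itvLab _ _ j
  have hi := i.2
  have hj := j.2
  unfold oddLab at hm; unfold parLab at hp; unfold itvLab
  split_ifs at hm hp ⊢ <;> omega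

/-- Vertices two steps apart become related when a step between them is in `x`. -/
theorem grow_rel_two (h : IsLen N L) {x : Setoid (Fin N)} {i j k : Fin N}
    (hk : (k : ℕ) ≤ L) (hik : (i : ℕ) + 1 = j) (hjk : (j : ℕ) + 1 = k) (hx : x i j ∨ x j k) :
    grow (par N L) (evn N L) (odd N L) x i k := by
  obtain ⟨h1, h2, h3, h4⟩ := h
  have hp : par N L i k := by
    change parLab L i = parLab L k
    unfold parLab; split_ifs <;> omega
  have step : ∀ u v : Fin N, (u : ℕ) + 1 = v → (v : ℕ) ≤ L → evn N L u v ∨ odd N L u v := by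
    intro u v huv hv
    rcases Nat.mod_two_eq_zero_or_one u with hu | hu
    · left
      change evenLab L u = evenLab L v
      unfold evenLab; split_ifs <;> omega
    · right
      change oddLab L u = oddLab L v
      unfold oddLab; split_ifs <;> omega
  rcases hx with hx | hx
  · rcases step j k hjk hk with hs | hs
    · exact sup_left (sup_right ⟨Setoid.trans' _ (sup_left hx) (sup_right hs), hp⟩)
    · exact sup_right ⟨Setoid.trans' _ (sup_left hx) (sup_right hs), hp⟩
  · rcases step i j hik (by omega) with hs | hs
    · exact sup_left (sup_right ⟨Setoid.trans' _ (sup_right hs) (sup_left hx), hp⟩)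
    · exact sup_right ⟨Setoid.trans' _ (sup_right hs) (sup_left hx), hp⟩

theorem itv_le_iff {x : Setoid (Fin N)} {a b : ℕ} :
    itv N a b ≤ x ↔ ∀ i j : Fin N, a ≤ (i : ℕ) → (i : ℕ) + 1 = j → (j : ℕ) ≤ b → x i j := by
  constructor
  · intro h i j hi hij hj
    refine h ?_
    change itvLab a b i = itvLab a b j
    unfold itvLab; split_ifs <;> omega
  · intro h
    have main : ∀ m : ℕ, ∀ i j : Fin N, a ≤ (i : ℕ) → (i : ℕ) + m = j → (j : ℕ) ≤ b → x i j := by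
      intro m
      induction m with
      | zero => intro i j _ hij _; rw [show i = j from Fin.ext (by omega)]
      | succ m ih =>
        intro i j hi hij hj
        have hlt : (i : ℕ) + m < N := by omega
        exact Setoid.trans' _ (ih i ⟨i + m, hlt⟩ hi rfl (by simp only; omega))
          (h ⟨i + m, hlt⟩ j (by simp only; omega) (by simp only; omega) hj)
    intro i j hij
    change itvLab a b i = itvLab a b j at hij
    have : i = j ∨ (a ≤ (i : ℕ) ∧ (i : ℕ) ≤ b ∧ a ≤ (j : ℕ) ∧ (j : ℕ) ≤ b) := by
      rw [Fin.ext_iff]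
      unfold itvLab at hij; split_ifs at hij <;> omega
    rcases this with rfl | ⟨h1, h2, h3, h4⟩
    · exact Setoid.refl' _ _
    · rcases le_total (i : ℕ) j with hle | hle
      · exact main (j - i) i j h1 (by omega) h4
      · exact Setoid.symm' _ (main (i - j) j i h3 (by omega) h2)

theorem le_grow {T : Type*} [Lattice T] (a b c x : T) : x ≤ grow a b c x :=
  le_sup_left.trans le_sup_left

theorem itv_le_grow (h : IsLen N L) {x : Setoid (Fin N)} {a b : ℕ} (hab : a < b) (hb : b ≤ L)
    (hx : itv N a b ≤ x) :
    itv N (a - 1) (min (b + 1) L) ≤ grow (par N L) (evn N L) (odd N L) x := by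
  have hN := h.lt
  rw [itv_le_iff] at hx ⊢
  have hg := le_grow (par N L) (evn N L) (odd N L) x
  intro i j hi hij hj
  by_cases h1 : (i : ℕ) < a
  -- The new vertex is reached by a detour: a jump of length two into the interval, then one edge
  -- back.
  · have h2 : (j : ℕ) + 1 < N := by omega
    have hjk := hx j ⟨j + 1, h2⟩ (by omega) rfl (by simp only; omega)
    exact Setoid.trans' _ (grow_rel_two h (i := i) (j := j) (k := ⟨j + 1, h2⟩)
      (by simp only; omega) hij rfl (Or.inr hjk)) (Setoid.symm' _ (hg hjk))
  by_cases h2 : b < (j : ℕ)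
  · have hlt : (i : ℕ) - 1 < N := by omega
    have hki := hx ⟨i - 1, hlt⟩ i (by simp only; omega) (by simp only; omega) (by omega)
    exact Setoid.trans' _ (Setoid.symm' _ (hg hki)) (grow_rel_two h (i := ⟨i - 1, hlt⟩) (j := i)
      (k := j) (by omega) (by simp only; omega) hij (Or.inl hki))
  · exact hg (hx i j (by omega) hij (by omega))

theorem grow_itv (h : IsLen N L) {a b : ℕ} (hab : a < b) (hb : b ≤ L) :
    grow (par N L) (evn N L) (odd N L) (itv N a b) = itv N (a - 1) (min (b + 1) L) := by
  refine le_antisymm ?_ (itv_le_grow h hab hb le_rfl)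
  refine sup_le (sup_le ?_ (itv_sup_evn_inf_par h hab hb)) (itv_sup_odd_inf_par h hab hb)
  rw [itv_le_iff]
  intro i j hi hij hj
  change itvLab _ _ i = itvLab _ _ j
  unfold itvLab; split_ifs <;> omega

theorem iterate_grow_zero (h : IsLen N L) (r : ℕ) (hr : r + 1 ≤ L) :
    (grow (par N L) (evn N L) (odd N L))^[r] (itv N 0 1) = itv N 0 (r + 1) := by
  induction r with
  | zero => rfl
  | succ r ih =>
    rw [Function.iterate_succ_apply', ih (by omega), grow_itv h (by omega) (by omega)]
    congr 2; omega

theorem iterate_grow_last (h : IsLen N L) (r : ℕ) (hr : r + 1 ≤ L) :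
    (grow (par N L) (evn N L) (odd N L))^[r] (itv N (L - 1) L) = itv N (L - 1 - r) L := by
  induction r with
  | zero => rfl
  | succ r ih =>
    rw [Function.iterate_succ_apply', ih (by omega), grow_itv h (by omega) le_rfl,
      show L - 1 - r - 1 = L - 1 - (r + 1) by omega, show min (L + 1) L = L by omega]

theorem itv_le_iterate_grow (h : IsLen N L) {x : Setoid (Fin N)} {a : ℕ} (ha : a + 1 ≤ L)
    (hx : itv N a (a + 1) ≤ x) (r : ℕ) :
    itv N (a - r) (min (a + 1 + r) L) ≤ (grow (par N L) (evn N L) (odd N L))^[r] x := by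
  induction r with
  | zero => simpa [Nat.min_eq_left ha] using hx
  | succ r ih =>
    rw [Function.iterate_succ_apply']
    have := itv_le_grow h (by omega) (by omega) ih
    rwa [show a - r - 1 = a - (r + 1) by omega,
      show min (min (a + 1 + r) L + 1) L = min (a + 1 + (r + 1)) L by omega] at this

/-- A partition containing an edge of the path grows to the top. -/
theorem exists_grow_eq_top (h : IsLen N L) {x : Setoid (Fin N)} {a : ℕ} (ha : a + 1 ≤ L)
    (hx : itv N a (a + 1) ≤ x) :
    (grow (par N L) (evn N L) (odd N L))^[L] x ⊔
      ((grow (par N L) (evn N L) (odd N L))^[L] x ⊔ evn N L) ⊓ odd N L = ⊤ := by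
  have h0 := itv_le_iterate_grow h ha hx L
  set y := (grow (par N L) (evn N L) (odd N L))^[L] x
  obtain ⟨h1, h2, h3, h4⟩ := h
  have hy : ∀ i : Fin N, (i : ℕ) ≤ L → y ⟨0, by omega⟩ i := fun i hi => h0 (by
    change itvLab _ _ _ = itvLab _ _ _
    unfold itvLab; simp only; split_ifs <;> omega)
  -- The vertex off the path is tied to `0` by `evn` and to `L` by `odd`; once `0` and `L` are
  -- related, the join-meet captures it.
  have hz : ∀ i : Fin N, (y ⊔ (y ⊔ evn N L) ⊓ odd N L) ⟨0, by omega⟩ i := by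
    intro i
    by_cases hi : (i : ℕ) ≤ L
    · exact sup_left (hy i hi)
    · have hl := hy ⟨L, h2⟩ le_rfl
      refine Setoid.trans' _ (sup_left hl) (sup_right ⟨?_, ?_⟩)
      · refine Setoid.trans' _ (sup_left (Setoid.symm' _ hl)) (sup_right ?_)
        change evenLab L _ = evenLab L _
        unfold evenLab; simp only; split_ifs <;> omega
      · change oddLab L _ = oddLab L _
        unfold oddLab; simp only; split_ifs <;> omega
  exact top_le_iff.1 fun i j _ => Setoid.trans' _ (Setoid.symm' _ (hz i)) (hz j)

/-- From a pair at distance two to an edge. -/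
theorem exists_edge_of_rel (h : IsLen N L) {x : Setoid (Fin N)} {i j : Fin N} (hi : 1 ≤ (i : ℕ))
    (hij : (i : ℕ) + 2 = j) (hj : (j : ℕ) < L) (hx : x i j) :
    ∃ a, a + 1 ≤ L ∧ itv N a (a + 1) ≤ (x ⊔ evn N L) ⊓ odd N L := by
  obtain ⟨h1, h2, h3, h4⟩ := h
  have hev : ∀ u v : Fin N, (u : ℕ) % 2 = 0 → (u : ℕ) + 1 = v → (v : ℕ) ≤ L →
      evn N L u v := by
    intro u v _ _ _
    change evenLab L u = evenLab L v
    unfold evenLab; split_ifs <;> omega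
  have hod : ∀ u v : Fin N, (u : ℕ) % 2 = 1 → (u : ℕ) + 1 = v → (v : ℕ) ≤ L →
      odd N L u v := by
    intro u v _ _ _
    change oddLab L u = oddLab L v
    unfold oddLab; split_ifs <;> omega
  rcases Nat.mod_two_eq_zero_or_one i with hm | hm
  · refine ⟨i + 1, by omega, itv_le_iff.2 fun u v hu huv hv => ⟨?_, hod u v (by omega) huv (by omega)⟩⟩
    obtain rfl : v = j := Fin.ext (by omega)
    exact Setoid.trans' _ (Setoid.symm' _ (sup_right (hev i u hm (by omega) (by omega))))
      (sup_left hx)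
  · refine ⟨i, by omega, itv_le_iff.2 fun u v hu huv hv => ⟨?_, hod u v (by omega) huv (by omega)⟩⟩
    obtain rfl : u = i := Fin.ext (by omega)
    exact Setoid.trans' _ (sup_left hx) (Setoid.symm' _ (sup_right (hev v j (by omega)
      (by omega) (by omega))))

/-- The pair `q, q + 2` is too far from the end of the path to reach its last edge. -/
theorem mark_par_sup_evn_inf (h : IsLen N L) (hq : 1 ≤ q) (hqL : q + 4 ≤ L) :
    (mark N L q ⊓ par N L ⊔ evn N L) ⊓ odd N L ⊓ mark N L q = ⊥ := by
  rw [inf_assoc, inf_comm (odd N L), mark_inf_odd h hq hqL]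
  -- The join only fuses the matching blocks of `q` and `q + 2`; both lie before the block of `L`,
  -- so `L - 1` and `L` stay apart.
  have key : mark N L q ⊓ par N L ⊔ evn N L ≤
      fib N fun i => if evenLab L i = (q + 2) / 2 then q / 2 else evenLab L i := by
    refine sup_le (fun i j hij => ?_) fun i j hij => ?_
    · rw [fib_rel]
      obtain ⟨h1, h2, h3, h4⟩ := h
      rcases eq_of_mark_inf_par ⟨h1, h2, h3, h4⟩ hq hqL hij with rfl | ⟨hi, hj⟩ | ⟨hi, hj⟩
      · rfl
      all_goals
        rw [hi, hj]
        unfold evenLab; split_ifs <;> omega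
    · have hij : evenLab L i = evenLab L j := hij
      rw [fib_rel, hij]
  obtain ⟨h1, h2, h3, h4⟩ := h
  refine le_bot_iff.1 fun i j ⟨hm, hp⟩ => Fin.ext ?_
  have hm := fib_rel.1 (key hm)
  change itvLab _ _ i = itvLab _ _ j at hp
  have hi := i.2
  have hj := j.2
  unfold evenLab at hm; unfold itvLab at hp
  split_ifs at hm hp <;> omega

theorem itv_last_le (h : IsLen N L) (hq : 1 ≤ q) (hqL : q + 4 ≤ L) :
    itv N (L - 1) L ≤ (mark N L q ⊓ evn N L ⊔ par N L) ⊓ odd N L ⊓ mark N L q := by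
  rw [inf_assoc, inf_comm (odd N L), mark_inf_odd h hq hqL, mark_inf_evn h hq hqL]
  refine le_inf ?_ le_rfl
  obtain ⟨h1, h2, h3, h4⟩ := h
  have hp : ∀ u v : Fin N, (u : ℕ) % 2 = (v : ℕ) % 2 → (u : ℕ) ≤ L → (v : ℕ) ≤ L →
      par N L u v := by
    intro u v _ _ _
    change parLab L u = parLab L v
    unfold parLab; split_ifs; omega
  rw [itv_le_iff]
  intro i j hi hij hj
  have he : itv N 0 1 ⟨1, by omega⟩ ⟨0, by omega⟩ := by
    change itvLab _ _ _ = itvLab _ _ _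
    simp [itvLab]
  -- The ends of the last edge have opposite parity, and the edge `{0,1}` links the two classes: `L
  -- - 1, 1, 0, L`.
  exact Setoid.trans' _ (sup_right (hp i ⟨1, by omega⟩ (by simp only; omega) (by omega)
    (by simp only; omega))) (Setoid.trans' _ (sup_left he) (sup_right (hp ⟨0, by omega⟩ j
    (by simp only; omega) (by simp only; omega) (by omega))))

end path
end PartitionPath

namespace PartitionPath

/-! ### Atoms and sublattices of a partition lattice -/

section atoms
variable {T : Type*} [DecidableEq T]

theorem atm_le_iff {u v : T} {x : Setoid T} : atm u v ≤ x ↔ x u v := by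
  constructor
  · intro h
    refine h ?_
    change (if u = v then u else u) = (if v = v then u else v)
    simp
  · intro h i j hij
    change (if i = v then u else i) = (if j = v then u else j) at hij
    split_ifs at hij with h1 h2 h2
    · subst h1 h2; exact Setoid.refl' _ _
    · subst h1 hij; exact Setoid.symm' _ h
    · subst h2 hij; exact h
    · subst hij; exact Setoid.refl' _ _

theorem atm_rel (u v : T) : atm u v u v := atm_le_iff.1 le_rfl

theorem atm_comm (u v : T) : atm u v = atm v u :=
  le_antisymm (atm_le_iff.2 (Setoid.symm' _ (atm_rel v u)))
    (atm_le_iff.2 (Setoid.symm' _ (atm_rel u v)))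

/-- An atom is the meet of the joins along two paths of length two between its ends. -/
theorem atm_eq_of_two_paths {u v w z : T} (huw : u ≠ w) (hwz : w ≠ z) :
    (atm u w ⊔ atm w v) ⊓ (atm u z ⊔ atm z v) = atm u v := by
  have key : ∀ t : T, atm u t ⊔ atm t v ≤ Setoid.ker fun i => if i = t ∨ i = v then u else i := by
    intro t
    refine sup_le (atm_le_iff.2 ?_) (atm_le_iff.2 ?_) <;> rw [Setoid.ker_def] <;> simp
  refine le_antisymm (fun i j ⟨h1, h2⟩ => ?_) (atm_le_iff.2
    ⟨Setoid.trans' _ (sup_left (atm_rel _ _)) (sup_right (atm_rel _ _)),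
      Setoid.trans' _ (sup_left (atm_rel _ _)) (sup_right (atm_rel _ _))⟩)
  have h1 := key _ h1
  have h2 := key _ h2
  rw [Setoid.ker_def] at h1 h2
  change (if i = v then u else i) = (if j = v then u else j)
  grind

/-- A sublattice of the partition lattice of a finite set which contains the bottom and the atoms
is everything. -/
theorem mem_of_atm_mem [Finite T] {S : Set (Setoid T)} (hS : IsSublattice S) (hbot : ⊥ ∈ S)
    (hatm : ∀ u v : T, u ≠ v → atm u v ∈ S) (x : Setoid T) : x ∈ S := by
  classical
  have := Fintype.ofFinite T
  have hx : x = (Finset.univ.filter fun p : T × T => p.1 ≠ p.2 ∧ x p.1 p.2).sup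
      fun p => atm p.1 p.2 := by
    refine le_antisymm (fun i j hij => ?_) (Finset.sup_le fun p hp => ?_)
    · by_cases h : i = j
      · rw [h]
      · exact (Finset.le_sup (f := fun p : T × T => atm p.1 p.2) (b := (i, j))
          (by simp [h, hij])) (atm_rel i j)
    · simp only [Finset.mem_filter, Finset.mem_univ, true_and] at hp
      exact atm_le_iff.2 hp.2
  rw [hx]
  refine Finset.sup_induction hbot (fun a ha b hb => hS.supClosed ha hb) fun p hp => ?_
  simp only [Finset.mem_filter, Finset.mem_univ, true_and] at hp
  exact hatm _ _ hp.1

end atoms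

section sublattice
variable {M : Type*} [Lattice M] {S : Set M}

theorem grow_mem (hS : IsSublattice S) {a b c x : M} (ha : a ∈ S) (hb : b ∈ S) (hc : c ∈ S)
    (hx : x ∈ S) : grow a b c x ∈ S :=
  hS.supClosed (hS.supClosed hx (hS.infClosed (hS.supClosed hx hb) ha))
    (hS.infClosed (hS.supClosed hx hc) ha)

theorem iterate_grow_mem (hS : IsSublattice S) {a b c x : M} (ha : a ∈ S) (hb : b ∈ S)
    (hc : c ∈ S) (hx : x ∈ S) (r : ℕ) : (grow a b c)^[r] x ∈ S := by
  induction r with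
  | zero => exact hx
  | succ r ih => rw [Function.iterate_succ_apply']; exact grow_mem hS ha hb hc ih

end sublattice

/-! ### Generating a single partition lattice -/

section generation
variable {N L q : ℕ} {S : Set (Setoid (Fin N))}

theorem itv_mem (h : IsLen N L) (hS : IsSublattice S) (hp : par N L ∈ S) (he : evn N L ∈ S)
    (ho : odd N L ∈ S) (hl : itv N 0 1 ∈ S) (hr : itv N (L - 1) L ∈ S) {a b : ℕ} (hab : a < b)
    (hb : b ≤ L) : itv N a b ∈ S := by
  have h1 := iterate_grow_mem hS hp he ho hl (b - 1)
  have h2 := iterate_grow_mem hS hp he ho hr (L - 1 - a)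
  rw [iterate_grow_zero h _ (by omega), show b - 1 + 1 = b by omega] at h1
  rw [iterate_grow_last h _ (by omega), show L - 1 - (L - 1 - a) = a by omega] at h2
  rw [← itv_inf_itv 0 b a L (by omega) hb]
  exact hS.infClosed h1 h2

theorem itv_succ_eq_atm {u v : Fin N} (huv : (u : ℕ) + 1 = v) : itv N u v = atm u v := by
  refine le_antisymm (itv_le_iff.2 fun i j hi hij hj => ?_) (atm_le_iff.2 ?_)
  · obtain rfl : i = u := Fin.ext (by omega)
    obtain rfl : j = v := Fin.ext (by omega)
    exact atm_rel _ _
  · change itvLab u v u = itvLab u v v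
    unfold itvLab; split_ifs <;> omega

theorem itv_inf_par_eq_atm {u v : Fin N} (huv : (u : ℕ) + 2 = v) (hv : (v : ℕ) ≤ L) :
    itv N u v ⊓ par N L = atm u v := by
  refine le_antisymm (fun i j hij => ?_) (atm_le_iff.2 ⟨?_, ?_⟩)
  · obtain ⟨h1, h2⟩ := hij
    change itvLab u v i = itvLab u v j at h1
    change parLab L i = parLab L j at h2
    have : i = j ∨ (i = u ∧ j = v) ∨ (i = v ∧ j = u) := by
      simp only [Fin.ext_iff]
      revert h1 h2
      unfold itvLab parLab
      split_ifs <;> (intros; omega)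
    rcases this with rfl | ⟨rfl, rfl⟩ | ⟨rfl, rfl⟩
    · exact Setoid.refl' _ _
    · exact atm_rel _ _
    · exact Setoid.symm' _ (atm_rel _ _)
  · change itvLab u v u = itvLab u v v
    unfold itvLab; split_ifs <;> omega
  · change parLab L u = parLab L v
    unfold parLab; split_ifs <;> omega

/-- Induction on the distance. Distances one and two come from intervals, the latter after a meet
with parity; a longer pair is reached through both `u + 1` and `u + 2`. -/
theorem atm_mem_of_lt (h : IsLen N L) (hS : IsSublattice S) (hp : par N L ∈ S)
    (he : evn N L ∈ S) (ho : odd N L ∈ S) (hl : itv N 0 1 ∈ S) (hr : itv N (L - 1) L ∈ S)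
    (m : ℕ) : ∀ u v : Fin N, (u : ℕ) < v → (v : ℕ) ≤ u + m → (v : ℕ) ≤ L → atm u v ∈ S := by
  have hi := @itv_mem N L S h hS hp he ho hl hr
  induction m with
  | zero => intro u v _ _; omega
  | succ m ih =>
    intro u v huv hvm hv
    by_cases h1 : (u : ℕ) + 1 = v
    · rw [← itv_succ_eq_atm h1]
      exact hi huv hv
    by_cases h2 : (u : ℕ) + 2 = v
    · rw [← itv_inf_par_eq_atm h2 hv]
      exact hS.infClosed (hi huv hv) hp
    have hw : (u : ℕ) + 1 < N := by omega
    have hz : (u : ℕ) + 2 < N := by omega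
    have hone : atm u ⟨u + 1, hw⟩ ∈ S := by
      rw [← itv_succ_eq_atm rfl]
      exact hi (a := u) (b := u + 1) (by omega) (by omega)
    have htwo : atm u ⟨u + 2, hz⟩ ∈ S := by
      rw [← itv_inf_par_eq_atm (L := L) rfl (by simp only; omega)]
      exact hS.infClosed (hi (a := u) (b := u + 2) (by omega) (by omega)) hp
    rw [← atm_eq_of_two_paths (w := ⟨u + 1, hw⟩) (z := ⟨u + 2, hz⟩) (by simp [Fin.ext_iff])
      (by simp [Fin.ext_iff])]
    exact hS.infClosed
      (hS.supClosed hone (ih _ _ (by simp only; omega) (by simp only; omega) hv))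
      (hS.supClosed htwo (ih _ _ (by simp only; omega) (by simp only; omega) hv))

/-- The vertex off the path is joined to `u` by passing from the far end of the path. -/
theorem atm_last_sup_odd_inf_evn (h : IsLen N L) {u l c : Fin N} (hu : (u : ℕ) ≤ 1)
    (hl : (l : ℕ) = L) (hc : (c : ℕ) = L + 1) : (atm u l ⊔ odd N L) ⊓ evn N L = atm u c := by
  obtain ⟨h1, h2, h3, h4⟩ := h
  refine le_antisymm (fun i j hij => ?_) (atm_le_iff.2 ⟨?_, ?_⟩)
  -- The join only fuses the `odd` blocks of `u` and `L`. Within the fused block, `u` and the vertex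
  -- off the path are the only two vertices sharing an `evn` block.
  · have key : atm u l ⊔ odd N L ≤
        fib N fun i => if oddLab L i = (u + 1) / 2 then L / 2 else oddLab L i := by
      refine sup_le (atm_le_iff.2 ?_) fun i j hij => ?_
      · rw [fib_rel, hl]
        unfold oddLab; split_ifs <;> omega
      · have hij : oddLab L i = oddLab L j := hij
        rw [fib_rel, hij]
    have hm := fib_rel.1 (key hij.1)
    have hp : evenLab L i = evenLab L j := hij.2
    have hi := i.2
    have hj := j.2
    have : i = j ∨ (i = u ∧ j = c) ∨ (i = c ∧ j = u) := by
      simp only [Fin.ext_iff]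
      revert hm hp
      unfold oddLab evenLab
      split_ifs <;> (intros; omega)
    rcases this with rfl | ⟨rfl, rfl⟩ | ⟨rfl, rfl⟩
    · exact Setoid.refl' _ _
    · exact atm_rel _ _
    · exact Setoid.symm' _ (atm_rel _ _)
  · refine Setoid.trans' _ (sup_left (atm_rel _ _)) (sup_right ?_)
    change oddLab L l = oddLab L c
    unfold oddLab; split_ifs <;> omega
  · change evenLab L u = evenLab L c
    unfold evenLab; split_ifs <;> omega

theorem atm_mem (h : IsLen N L) (hS : IsSublattice S) (hp : par N L ∈ S)
    (he : evn N L ∈ S) (ho : odd N L ∈ S) (hl : itv N 0 1 ∈ S) (hr : itv N (L - 1) L ∈ S)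
    (u v : Fin N) (huv : u ≠ v) : atm u v ∈ S := by
  wlog hlt : u < v generalizing u v
  · rw [atm_comm]
    exact this v u huv.symm (lt_of_le_of_ne (not_lt.1 hlt) huv.symm)
  have hm := fun u v => atm_mem_of_lt h hS hp he ho hl hr N u v
  have h' := h
  obtain ⟨h1, h2, h3, h4⟩ := h
  by_cases hv : (v : ℕ) ≤ L
  · exact hm u v hlt (by omega) hv
  have hsmall : ∀ w : Fin N, (w : ℕ) ≤ 1 → atm w v ∈ S := by
    intro w hw
    rw [← atm_last_sup_odd_inf_evn h' (l := ⟨L, h2⟩) hw rfl (by omega)]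
    exact hS.infClosed (hS.supClosed (hm _ _ (by simp only; omega)
      (by simp only; omega) le_rfl) ho) he
  by_cases hu : (u : ℕ) ≤ 1
  · exact hsmall u hu
  have h0 : 0 < N := by omega
  have h1' : 1 < N := by omega
  -- Any other `u` reaches the vertex off the path through both `0` and `1`.
  rw [← atm_eq_of_two_paths (w := ⟨0, h0⟩) (z := ⟨1, h1'⟩)
    (by simp only [ne_eq, Fin.ext_iff]; omega) (by simp [Fin.ext_iff]), atm_comm u, atm_comm u]
  refine hS.infClosed (hS.supClosed (hm _ _ ?_ ?_ ?_) (hsmall _ ?_))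
    (hS.supClosed (hm _ _ ?_ ?_ ?_) (hsmall _ ?_)) <;>
    (try simp only) <;> omega

/-- The four partitions generate the partition lattice. -/
theorem mem_of_generators_mem (h : IsLen N L) (hq : 1 ≤ q) (hqL : q + 4 ≤ L)
    (hS : IsSublattice S) (hp : par N L ∈ S) (he : evn N L ∈ S) (ho : odd N L ∈ S)
    (hm : mark N L q ∈ S) (x : Setoid (Fin N)) : x ∈ S := by
  refine mem_of_atm_mem hS ?_ (atm_mem h hS hp he ho ?_ ?_) x
  · rw [← par_inf_evn h]; exact hS.infClosed hp he
  · rw [← mark_inf_evn h hq hqL]; exact hS.infClosed hm he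
  · rw [← mark_inf_odd h hq hqL]; exact hS.infClosed hm ho

end generation
end PartitionPath

namespace PartitionPath

/-! ### Sublattices of a finite product -/

section product
variable {ι : Type*} {M : ι → Type*} [∀ i, Lattice (M i)] [∀ i, BoundedOrder (M i)]
  {S : Set (∀ i, M i)}

/-- Some member of `S` is the top in coordinate `i` and the bottom in coordinate `j`. -/
def Separates (S : Set (∀ i, M i)) (i j : ι) : Prop := ∃ z ∈ S, z i = ⊤ ∧ z j = ⊥

/-- A sublattice of a finite product which projects onto every factor and separates every two
coordinates is everything. -/
theorem mem_of_separates [Finite ι] (hS : IsSublattice S) (hbot : ⊥ ∈ S)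
    (hproj : ∀ i (x : M i), ∃ z ∈ S, z i = x) (hsep : ∀ i j, i ≠ j → Separates S i j)
    (y : ∀ i, M i) : y ∈ S := by
  classical
  have := Fintype.ofFinite ι
  -- Meeting with separating elements clears the other coordinates one at a time; `y` is then the
  -- join of these one-coordinate elements.
  have hone : ∀ i, ∃ z ∈ S, z i = y i ∧ ∀ j, j ≠ i → z j = ⊥ := by
    intro i
    have : ∀ J : Finset ι, i ∉ J → ∃ z ∈ S, z i = y i ∧ ∀ j ∈ J, z j = ⊥ := by
      intro J
      induction J using Finset.induction_on with
      | empty =>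
        intro _
        obtain ⟨z, hz, hzi⟩ := hproj i (y i)
        exact ⟨z, hz, hzi, by simp⟩
      | insert j J _ ih =>
        intro hi
        rw [Finset.mem_insert, not_or] at hi
        obtain ⟨z, hz, hzi, hzJ⟩ := ih hi.2
        obtain ⟨w, hw, hwi, hwj⟩ := hsep i j hi.1
        refine ⟨z ⊓ w, hS.infClosed hz hw, by simp [hzi, hwi], fun k hk => ?_⟩
        rcases Finset.mem_insert.1 hk with rfl | hk
        · simp [hwj]
        · simp [hzJ k hk]
    obtain ⟨z, hz, hzi, hzJ⟩ := this (Finset.univ.erase i) (by simp)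
    exact ⟨z, hz, hzi, fun j hj => hzJ j (by simp [hj])⟩
  have : ∀ J : Finset ι, ∃ z ∈ S, (∀ i ∈ J, z i = y i) ∧ ∀ i, i ∉ J → z i = ⊥ := by
    intro J
    induction J using Finset.induction_on with
    | empty => exact ⟨⊥, hbot, by simp, by simp⟩
    | insert j J hj ih =>
      obtain ⟨z, hz, hzJ, hz0⟩ := ih
      obtain ⟨w, hw, hwj, hw0⟩ := hone j
      refine ⟨z ⊔ w, hS.supClosed hz hw, fun k hk => ?_, fun k hk => ?_⟩
      · rcases Finset.mem_insert.1 hk with rfl | hk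
        · simp [hz0 k hj, hwj]
        · have : k ≠ j := fun h => hj (h ▸ hk)
          simp [hzJ k hk, hw0 k this]
      · rw [Finset.mem_insert, not_or] at hk
        simp [hz0 k hk.2, hw0 k hk.1]
  obtain ⟨z, hz, hzJ, -⟩ := this Finset.univ
  rwa [← show z = y from funext fun i => hzJ i (Finset.mem_univ i)]

omit [∀ i, BoundedOrder (M i)] in
theorem iterate_grow_apply (a b c x : ∀ i, M i) (r : ℕ) (i : ι) :
    ((grow a b c)^[r] x) i = (grow (a i) (b i) (c i))^[r] (x i) := by
  induction r with
  | zero => rfl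
  | succ r ih => rw [Function.iterate_succ_apply', Function.iterate_succ_apply', ← ih]; rfl

end product

/-- `a`, `b`, `c`, `d` are the four generating partitions for a path of length `L`. -/
structure IsFrame {N : ℕ} (L q : ℕ) (a b c d : Setoid (Fin N)) : Prop where
  len : IsLen N L
  one_le : 1 ≤ q
  add_four_le : q + 4 ≤ L
  par_eq : a = par N L
  evn_eq : b = evn N L
  odd_eq : c = odd N L
  mark_eq : d = mark N L q

namespace IsFrame
variable {N L q : ℕ} {a b c d : Setoid (Fin N)} (h : IsFrame L q a b c d)
include h

theorem inf_ab : a ⊓ b = ⊥ := by rw [h.par_eq, h.evn_eq, par_inf_evn h.len]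
theorem inf_ac : a ⊓ c = ⊥ := by rw [h.par_eq, h.odd_eq, par_inf_odd h.len]
theorem inf_bc : b ⊓ c = ⊥ := by rw [h.evn_eq, h.odd_eq, evn_inf_odd h.len]
theorem inf_db : d ⊓ b = itv N 0 1 := by
  rw [h.mark_eq, h.evn_eq, mark_inf_evn h.len h.one_le h.add_four_le]
theorem inf_dc : d ⊓ c = itv N (L - 1) L := by
  rw [h.mark_eq, h.odd_eq, mark_inf_odd h.len h.one_le h.add_four_le]

/-- Equality of two generators would make their known meet equal to each of them, contradicted by a
pair of small vertices. In the case `a = d`, the meets with `b` already differ. -/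
theorem pairwise_ne : a ≠ b ∧ a ≠ c ∧ a ≠ d ∧ b ≠ c ∧ b ≠ d ∧ c ≠ d := by
  have hab := h.inf_ab
  have hac := h.inf_ac
  have hbc := h.inf_bc
  have hdb := h.inf_db
  have hdc := h.inf_dc
  obtain ⟨⟨h1, h2, h3, h4⟩, h5, h6, ha, hb, hc, hd⟩ := h
  have lt : ∀ k, k ≤ 8 → k < N := fun k hk => by omega
  have a02 : a ⟨0, lt 0 (by norm_num)⟩ ⟨2, lt 2 (by norm_num)⟩ := by
    rw [ha, fib_rel]; simp only [parLab]; split_ifs <;> omega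
  have b01 : b ⟨0, lt 0 (by norm_num)⟩ ⟨1, lt 1 (by norm_num)⟩ := by
    rw [hb, fib_rel]; simp only [evenLab]; split_ifs <;> omega
  have b23 : b ⟨2, lt 2 (by norm_num)⟩ ⟨3, lt 3 (by norm_num)⟩ := by
    rw [hb, fib_rel]; simp only [evenLab]; split_ifs <;> omega
  have c12 : c ⟨1, lt 1 (by norm_num)⟩ ⟨2, lt 2 (by norm_num)⟩ := by
    rw [hc, fib_rel]; simp only [oddLab]; split_ifs <;> omega
  have i01 : itv N 0 1 ⟨0, lt 0 (by norm_num)⟩ ⟨1, lt 1 (by norm_num)⟩ := by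
    rw [fib_rel]; simp [itvLab]
  refine ⟨?_, ?_, ?_, ?_, ?_, ?_⟩
  · rintro rfl
    rw [inf_idem] at hab
    rw [hab] at a02
    exact absurd (Fin.ext_iff.1 a02) (by norm_num)
  · rintro rfl
    rw [inf_idem] at hac
    rw [hac] at a02
    exact absurd (Fin.ext_iff.1 a02) (by norm_num)
  · rintro rfl
    rw [← hdb, hab] at i01
    exact absurd (Fin.ext_iff.1 i01) (by norm_num)
  · rintro rfl
    rw [inf_idem] at hbc
    rw [hbc] at b01
    exact absurd (Fin.ext_iff.1 b01) (by norm_num)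
  · rintro rfl
    rw [inf_idem] at hdb
    rw [hdb, fib_rel] at b23
    simp [itvLab] at b23
  · rintro rfl
    rw [inf_idem] at hdc
    rw [hdc, fib_rel] at c12
    unfold itvLab at c12
    simp only at c12
    split_ifs at c12 <;> omega

end IsFrame

/-! ### Separating two coordinates -/

section separation
variable {ι : Type*} {N L q : ι → ℕ} {S : Set (∀ i, Setoid (Fin (N i)))}
  {a b c d : ∀ i, Setoid (Fin (N i))} {i j : ι}

/-- An element with an edge of the path in coordinate `i` and trivial in coordinate `j`. -/
theorem separates_of_edge (hS : IsSublattice S) (ha : a ∈ S) (hb : b ∈ S) (hc : c ∈ S)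
    (hi : IsFrame (L i) (q i) (a i) (b i) (c i) (d i)) (hab : a j ⊓ b j = ⊥)
    (hac : a j ⊓ c j = ⊥) (hbc : b j ⊓ c j = ⊥) {x : ∀ i, Setoid (Fin (N i))} (hx : x ∈ S)
    {p : ℕ} (hp : p + 1 ≤ L i) (hxi : itv (N i) p (p + 1) ≤ x i) (hxj : x j = ⊥) :
    Separates S i j := by
  have hy := iterate_grow_mem hS ha hb hc hx (L i)
  have hyi := iterate_grow_apply a b c x (L i) i
  have hyj := iterate_grow_apply a b c x (L i) j
  -- Bottom does not grow, because `a` meets both matchings trivially; this is symmetric enough to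
  -- hold also when `a` and `b` are exchanged in coordinate `j`.
  have hbot : grow (a j) (b j) (c j) ⊥ = ⊥ := by
    unfold grow
    rw [bot_sup_eq, bot_sup_eq, bot_sup_eq, inf_comm, hab, inf_comm, hac, bot_sup_eq]
  rw [hxj, Function.iterate_fixed hbot] at hyj
  refine ⟨_, hS.supClosed hy (hS.infClosed (hS.supClosed hy hb) hc), ?_, ?_⟩
  · rw [Pi.sup_apply, Pi.inf_apply, Pi.sup_apply, hyi, hi.par_eq, hi.evn_eq, hi.odd_eq]
    exact exists_grow_eq_top hi.len hp hxi
  · rw [Pi.sup_apply, Pi.inf_apply, Pi.sup_apply, hyj, bot_sup_eq, bot_sup_eq, hbc]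

theorem iterate_grow_apply_zero (r : ℕ) (hi : IsFrame (L i) (q i) (a i) (b i) (c i) (d i))
    (hr : r + 1 ≤ L i) : ((grow a b c)^[r] (d ⊓ b)) i = itv (N i) 0 (r + 1) := by
  rw [iterate_grow_apply, Pi.inf_apply, hi.inf_db, hi.par_eq, hi.evn_eq, hi.odd_eq,
    iterate_grow_zero hi.len r hr]

/-- Growth from the left end reaches the right end of the shorter path first. -/
theorem separates_of_length_lt (hS : IsSublattice S) (ha : a ∈ S) (hb : b ∈ S) (hc : c ∈ S)
    (hd : d ∈ S) (hi : IsFrame (L i) (q i) (a i) (b i) (c i) (d i))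
    (hj : IsFrame (L j) (q j) (a j) (b j) (c j) (d j)) (hij : L i < L j) : Separates S i j := by
  have hLi := hi.len.eight_le
  have hei := hi.len.even
  have hej := hj.len.even
  refine separates_of_edge hS ha hb hc hi hj.inf_ab hj.inf_ac hj.inf_bc
    -- After `L i - 1` steps the edge `{0,1}` has become the whole path in coordinate `i`, but in
    -- coordinate `j` it stops short of the last vertex.
    (x := (grow a b c)^[L i - 1] (d ⊓ b) ⊓ (d ⊓ c))
    (hS.infClosed (iterate_grow_mem hS ha hb hc (hS.infClosed hd hb) _) (hS.infClosed hd hc))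
    (p := L i - 1) (by omega) ?_ ?_
  · rw [Pi.inf_apply, iterate_grow_apply_zero _ hi (by omega), Pi.inf_apply, hi.inf_dc,
      itv_inf_itv _ _ _ _ (by omega) (by omega)]
  · rw [Pi.inf_apply, iterate_grow_apply_zero _ hj (by omega), Pi.inf_apply, hj.inf_dc]
    refine fib_inf_eq_bot fun u v hu hv => ?_
    unfold itvLab
    split_ifs <;> (intros; omega)

/-- Growth from the left end first reaches the middle pair which is further to the left. -/
theorem separates_of_position_lt (hS : IsSublattice S) (ha : a ∈ S) (hb : b ∈ S) (hc : c ∈ S)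
    (hd : d ∈ S) (hi : IsFrame (L i) (q i) (a i) (b i) (c i) (d i))
    (hj : IsFrame (L j) (q j) (a j) (b j) (c j) (d j)) (hij : q i < q j) : Separates S i j := by
  have hqi := hi.add_four_le
  have hqj := hj.add_four_le
  have hlt := hi.len.lt
  -- After `q i + 1` steps the interval is `0, …, q i + 2`: it contains the marked pair in
  -- coordinate `i` and misses `q j + 2` in coordinate `j`.
  set x := (grow a b c)^[q i + 1] (d ⊓ b) ⊓ (d ⊓ a)
  have hx : x ∈ S :=
    hS.infClosed (iterate_grow_mem hS ha hb hc (hS.infClosed hd hb) _) (hS.infClosed hd ha)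
  have hxi : x i ⟨q i, by omega⟩ ⟨q i + 2, by omega⟩ := by
    change (((grow a b c)^[q i + 1] (d ⊓ b)) i ⊓ (d i ⊓ a i)) _ _
    rw [iterate_grow_apply_zero _ hi (by omega), hi.mark_eq, hi.par_eq]
    refine ⟨?_, mark_inf_par_rel hi.len hi.one_le hqi rfl rfl⟩
    change itvLab _ _ _ = itvLab _ _ _
    unfold itvLab; simp only; split_ifs <;> omega
  have hxj : x j = ⊥ := by
    change ((grow a b c)^[q i + 1] (d ⊓ b)) j ⊓ (d j ⊓ a j) = ⊥
    rw [iterate_grow_apply_zero _ hj (by omega), hj.mark_eq, hj.par_eq]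
    refine le_bot_iff.1 fun u v huv => ?_
    obtain ⟨h1, h2⟩ := huv
    change itvLab _ _ u = itvLab _ _ v at h1
    rcases eq_of_mark_inf_par hj.len hj.one_le hqj h2 with h2 | ⟨hu, hv⟩ | ⟨hu, hv⟩
    · exact h2
    all_goals
      exfalso
      rw [hu, hv] at h1
      unfold itvLab at h1
      split_ifs at h1 <;> omega
  obtain ⟨p, hp, hpx⟩ := exists_edge_of_rel hi.len hi.one_le rfl (by simp only; omega) hxi
  refine separates_of_edge hS ha hb hc hi hj.inf_ab hj.inf_ac hj.inf_bc
    (x := (x ⊔ b) ⊓ c) (hS.infClosed (hS.supClosed hx hb) hc) hp ?_ ?_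
  · rwa [Pi.inf_apply, Pi.sup_apply, hi.evn_eq, hi.odd_eq]
  · rw [Pi.inf_apply, Pi.sup_apply, hxj, bot_sup_eq, hj.inf_bc]

/-- Coordinates in which the first two generators have exchanged roles are separated. -/
theorem separates_of_swap (hS : IsSublattice S) (ha : a ∈ S) (hb : b ∈ S) (hc : c ∈ S)
    (hd : d ∈ S) (hi : IsFrame (L i) (q i) (a i) (b i) (c i) (d i))
    (hj : IsFrame (L j) (q j) (b j) (a j) (c j) (d j)) : Separates S i j := by
  have hLi := hi.len.eight_le
  refine separates_of_edge hS ha hb hc hi (by rw [inf_comm, hj.inf_ab]) hj.inf_bc hj.inf_ac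
    -- In coordinate `i`, `d ⊓ b` is an end edge and `a` is parity, so the last edge is reached; in
    -- coordinate `j`, `d ⊓ b` is the marked pair up to the `q j = 1` merging removed by parity, and
    -- the matching `a` carries it only locally.
    (x := (d ⊓ b ⊔ a) ⊓ c ⊓ d)
    (hS.infClosed (hS.infClosed (hS.supClosed (hS.infClosed hd hb) ha) hc) hd)
    (p := L i - 1) (by omega) ?_ ?_
  · rw [show L i - 1 + 1 = L i by omega]
    change _ ≤ (d i ⊓ b i ⊔ a i) ⊓ c i ⊓ d i
    rw [hi.mark_eq, hi.par_eq, hi.evn_eq, hi.odd_eq]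
    exact itv_last_le hi.len hi.one_le hi.add_four_le
  · change (d j ⊓ b j ⊔ a j) ⊓ c j ⊓ d j = ⊥
    rw [hj.mark_eq, hj.par_eq, hj.evn_eq, hj.odd_eq]
    exact mark_par_sup_evn_inf hj.len hj.one_le hj.add_four_le

/-- The projection to a framed coordinate is onto. -/
theorem exists_mem_apply_eq (hS : IsSublattice S) (ha : a ∈ S) (hb : b ∈ S) (hc : c ∈ S)
    (hd : d ∈ S) (hi : IsFrame (L i) (q i) (a i) (b i) (c i) (d i)) (x : Setoid (Fin (N i))) :
    ∃ z ∈ S, z i = x := by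
  refine mem_of_generators_mem (S := {x | ∃ z ∈ S, z i = x}) hi.len hi.one_le hi.add_four_le
    ⟨?_, ?_⟩ ⟨a, ha, hi.par_eq⟩ ⟨b, hb, hi.evn_eq⟩ ⟨c, hc, hi.odd_eq⟩ ⟨d, hd, hi.mark_eq⟩ x
  · rintro _ ⟨z, hz, rfl⟩ _ ⟨w, hw, rfl⟩
    exact ⟨z ⊔ w, hS.supClosed hz hw, rfl⟩
  · rintro _ ⟨z, hz, rfl⟩ _ ⟨w, hw, rfl⟩
    exact ⟨z ⊓ w, hS.infClosed hz hw, rfl⟩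

end separation

/-! ### The generators for the sizes from `n` to `3n - 14` -/

section family
variable {n : ℕ}

/-- The length of the path in `Fin m`. -/
def pathLen (m : ℕ) : ℕ := 2 * ((m - 1) / 2)

/-- The position of the middle pair in `Fin m`, decreasing along each parity class. -/
def midPos (n m : ℕ) : ℕ := (3 * n - 14 - m) / 2 + 1

def genA (n : ℕ) (i : Set.Icc n (3 * n - 14)) : Setoid (Fin i) :=
  if (i : ℕ) % 2 = 1 then par i (pathLen i) else evn i (pathLen i)

def genB (n : ℕ) (i : Set.Icc n (3 * n - 14)) : Setoid (Fin i) :=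
  if (i : ℕ) % 2 = 1 then evn i (pathLen i) else par i (pathLen i)

def genC (n : ℕ) (i : Set.Icc n (3 * n - 14)) : Setoid (Fin i) := odd i (pathLen i)

def genD (n : ℕ) (i : Set.Icc n (3 * n - 14)) : Setoid (Fin i) :=
  mark i (pathLen i) (midPos n i)

theorem isFrame_of_odd (hn : 9 ≤ n) (i : Set.Icc n (3 * n - 14)) (hi : (i : ℕ) % 2 = 1) :
    IsFrame (pathLen i) (midPos n i) (genA n i) (genB n i) (genC n i) (genD n i) := by
  obtain ⟨m, h1, h2⟩ := i
  simp only at hi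
  refine ⟨⟨?_, ?_, ?_, ?_⟩, ?_, ?_, if_pos hi, if_pos hi, rfl, rfl⟩ <;>
    simp only [pathLen, midPos] <;> omega

/-- The range of sizes is limited by room for the marked pair: its position is `1` at size `3n - 14`
and `n - 6` at size `n`, where for even `n` the path has length `n - 2` and the bound `q + 4 ≤ L` is
attained. -/
theorem isFrame_of_even (hn : 9 ≤ n) (i : Set.Icc n (3 * n - 14)) (hi : (i : ℕ) % 2 ≠ 1) :
    IsFrame (pathLen i) (midPos n i) (genB n i) (genA n i) (genC n i) (genD n i) := by
  obtain ⟨m, h1, h2⟩ := i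
  simp only at hi
  refine ⟨⟨?_, ?_, ?_, ?_⟩, ?_, ?_, if_neg hi, if_neg hi, rfl, rfl⟩ <;>
    simp only [pathLen, midPos] <;> omega

theorem length_or_position_lt (hn : 9 ≤ n) {i j : Set.Icc n (3 * n - 14)} (hij : i ≠ j)
    (h : (i : ℕ) % 2 = (j : ℕ) % 2) : pathLen i < pathLen j ∨ midPos n i < midPos n j := by
  have hij' : (i : ℕ) ≠ j := fun h => hij (Subtype.ext h)
  have hi := i.2.2
  have hj := j.2.2
  have hi1 := i.2.1
  have hj1 := j.2.1
  unfold pathLen midPos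
  rcases lt_or_gt_of_ne hij' with hlt | hlt
  · left; omega
  · right; omega

theorem mem_of_gen_mem (hn : 9 ≤ n) {S : Set (∀ i : Set.Icc n (3 * n - 14), Setoid (Fin i))}
    (hS : IsSublattice S) (ha : genA n ∈ S) (hb : genB n ∈ S) (hc : genC n ∈ S)
    (hd : genD n ∈ S) (x : ∀ i : Set.Icc n (3 * n - 14), Setoid (Fin i)) : x ∈ S := by
  refine mem_of_separates hS ?_ (fun i y => ?_) (fun i j hij => ?_) x
  · have hab : genA n ⊓ genB n = ⊥ := by
      funext i
      by_cases hi : (i : ℕ) % 2 = 1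
      · exact (isFrame_of_odd hn i hi).inf_ab
      · exact (inf_comm _ _).trans (isFrame_of_even hn i hi).inf_ab
    exact hab ▸ hS.infClosed ha hb
  · by_cases hi : (i : ℕ) % 2 = 1
    · exact exists_mem_apply_eq (L := fun i : Set.Icc n (3 * n - 14) => pathLen i)
        (q := fun i : Set.Icc n (3 * n - 14) => midPos n i) hS ha hb hc hd
        (isFrame_of_odd hn i hi) y
    · exact exists_mem_apply_eq (L := fun i : Set.Icc n (3 * n - 14) => pathLen i)
        (q := fun i : Set.Icc n (3 * n - 14) => midPos n i) hS hb ha hc hd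
        (isFrame_of_even hn i hi) y
  · have sep : ∀ {a b : ∀ i : Set.Icc n (3 * n - 14), Setoid (Fin i)}, a ∈ S → b ∈ S →
        IsFrame (pathLen i) (midPos n i) (a i) (b i) (genC n i) (genD n i) →
        IsFrame (pathLen j) (midPos n j) (a j) (b j) (genC n j) (genD n j) →
        (i : ℕ) % 2 = (j : ℕ) % 2 → Separates S i j := by
      intro a b ha hb hi hj h
      rcases length_or_position_lt hn hij h with h | h
      · exact separates_of_length_lt (L := fun i : Set.Icc n (3 * n - 14) => pathLen i)
          (q := fun i : Set.Icc n (3 * n - 14) => midPos n i) hS ha hb hc hd hi hj h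
      · exact separates_of_position_lt (L := fun i : Set.Icc n (3 * n - 14) => pathLen i)
          (q := fun i : Set.Icc n (3 * n - 14) => midPos n i) hS ha hb hc hd hi hj h
    by_cases hi : (i : ℕ) % 2 = 1 <;> by_cases hj : (j : ℕ) % 2 = 1
    · exact sep ha hb (isFrame_of_odd hn i hi) (isFrame_of_odd hn j hj) (by omega)
    · exact separates_of_swap (L := fun i : Set.Icc n (3 * n - 14) => pathLen i)
          (q := fun i : Set.Icc n (3 * n - 14) => midPos n i) hS ha hb hc hd
          (isFrame_of_odd hn i hi) (isFrame_of_even hn j hj)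
    · exact separates_of_swap (L := fun i : Set.Icc n (3 * n - 14) => pathLen i)
          (q := fun i : Set.Icc n (3 * n - 14) => midPos n i) hS hb ha hc hd
          (isFrame_of_even hn i hi) (isFrame_of_odd hn j hj)
    · exact sep hb ha (isFrame_of_even hn i hi) (isFrame_of_even hn j hj) (by omega)

theorem gen_pairwise_ne (hn : 9 ≤ n) : genA n ≠ genB n ∧ genA n ≠ genC n ∧ genA n ≠ genD n ∧
    genB n ≠ genC n ∧ genB n ≠ genD n ∧ genC n ≠ genD n := by
  -- Distinctness in the single coordinate `n` suffices.
  have hmem : n ∈ Set.Icc n (3 * n - 14) := ⟨le_rfl, by omega⟩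
  by_cases hi : n % 2 = 1
  · obtain ⟨h1, h2, h3, h4, h5, h6⟩ := (isFrame_of_odd hn ⟨n, hmem⟩ hi).pairwise_ne
    exact ⟨fun h => h1 (congrFun h _), fun h => h2 (congrFun h _), fun h => h3 (congrFun h _),
      fun h => h4 (congrFun h _), fun h => h5 (congrFun h _), fun h => h6 (congrFun h _)⟩
  · obtain ⟨h1, h2, h3, h4, h5, h6⟩ := (isFrame_of_even hn ⟨n, hmem⟩ hi).pairwise_ne
    exact ⟨fun h => h1 (congrFun h _).symm, fun h => h4 (congrFun h _),
      fun h => h5 (congrFun h _), fun h => h2 (congrFun h _), fun h => h3 (congrFun h _),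
      fun h => h6 (congrFun h _)⟩

end family

end PartitionPath

/-! ### Transfer from equivalence relations to partitions -/

open PartitionPath in
theorem corollary3p4 (n : ℕ) (hn : 9 ≤ n) :
    IsFourGenerated (∀ i : Set.Icc n (3 * n - 14), PartLattice i) := by
  set φ : (∀ i : Set.Icc n (3 * n - 14), Setoid (Fin i)) →
      ∀ i : Set.Icc n (3 * n - 14), PartLattice i :=
    fun s i => Setoid.Partition.orderIso _ (s i)
  have hinj : Function.Injective φ := fun s t h =>
    funext fun i => (Setoid.Partition.orderIso _).injective (congrFun h i)
  have hsup : ∀ s t, φ (s ⊔ t) = φ s ⊔ φ t := fun s t =>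
    funext fun i => map_sup (Setoid.Partition.orderIso (Fin i)) (s i) (t i)
  have hinf : ∀ s t, φ (s ⊓ t) = φ s ⊓ φ t := fun s t =>
    funext fun i => map_inf (Setoid.Partition.orderIso (Fin i)) (s i) (t i)
  refine ⟨{φ (genA n), φ (genB n), φ (genC n), φ (genD n)}, ?_, ?_⟩
  · obtain ⟨h1, h2, h3, h4, h5, h6⟩ := gen_pairwise_ne hn
    rw [Set.ncard_insert_of_notMem, Set.ncard_insert_of_notMem, Set.ncard_pair] <;>
      simp [hinj.eq_iff, h1, h2, h3, h4, h5, h6]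
  · set X : Set (∀ i : Set.Icc n (3 * n - 14), PartLattice i) :=
      {φ (genA n), φ (genB n), φ (genC n), φ (genD n)}
    have hX : IsSublattice (latticeClosure X) := isSublattice_latticeClosure
    -- The closure is pulled back along the isomorphism, so that generation can be checked on
    -- equivalence relations.
    have hS : IsSublattice (φ ⁻¹' latticeClosure X) :=
      ⟨fun s hs t ht => by
        rw [Set.mem_preimage, hsup]; exact hX.supClosed hs ht,
      fun s hs t ht => by
        rw [Set.mem_preimage, hinf]; exact hX.infClosed hs ht⟩
    have hsub : ∀ y ∈ X, y ∈ latticeClosure X := fun y hy => subset_latticeClosure hy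
    refine Set.eq_univ_of_forall fun y => ?_
    have := mem_of_gen_mem hn hS (hsub _ (by simp [X])) (hsub _ (by simp [X]))
      (hsub _ (by simp [X])) (hsub _ (by simp [X]))
      fun i => (Setoid.Partition.orderIso _).symm (y i)
    rw [Set.mem_preimage] at this
    convert this using 1
    exact funext fun i => ((Setoid.Partition.orderIso _).apply_symm_apply (y i)).symm
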